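/- Notation. A function $\alpha:\mathbb{R}_{\ge 0}\to\mathbb{R}_{\ge 0}$ is of class $\mathcal{K}$ if it is continuous, strictly increasing and $\alpha(0)=0$, and of class $\mathcal{K}_\infty$ if in addition it is unbounded. A function $\beta:\mathbb{R}_{\ge 0}\times\mathbb{R}_{\ge 0}\to\mathbb{R}_{\ge 0}$ is of class $\mathcal{KL}$ if $\beta(\cdot,t)\in\mathcal{K}$ for every $t\ge 0$ and, for every $r\ge 0$, $\beta(r,t)$ decreases monotonically to $0$ as $t\to\infty$. $|\cdot|$ is the Euclidean norm. System. Let $\tau\ge 0$ and let $\mathcal{C}=C([-\tau,0],\mathbb{R}^n)$ carry the supremum norm $\|\cdot\|$. Let $\mathcal{U}$ be the set of all locally bounded, Lebesgue measurable $u:[0,\infty)\to\mathbb{R}^m$. For $u\in\mathcal{U}$, $\kappa\in\mathcal{K}_\infty$ and $0\le t_0\le t$, let $\|u_{(t_0,t]}\|_\kappa=\int_{t_0}^{t}\kappa(|u(s)|)\,ds$. Consider $$\dot x(t)=f(t,x_t,u(t)),\qquad x_t(s)=x(t+s)\ \text{ for } s\in[-\tau,0], \tag{1}$$ where $f:\mathbb{R}_{\ge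 0}\times\mathcal{C}\times\mathbb{R}^m\to\mathbb{R}^n$ is such that $f(t,\cdot,\cdot)$ is continuous for every $t\ge 0$ and $f(\cdot,\psi,\mu)$ is Lebesgue measurable for every $(\psi,\mu)$. A solution of (1) for the initial time $t_0\ge 0$, the initial state $\psi\in\mathcal{C}$ and the input $u\in\mathcal{U}$ is a continuous $x:[t_0-\tau,T)\to\mathbb{R}^n$, $t_0<T\le\infty$, with $x_{t_0}=\psi$, that is locally absolutely continuous on $[t_0,T)$ and satisfies (1) for almost every $t\in[t_0,T)$. Assume that for all $t_0\ge 0$, $\psi\in\mathcal{C}$ and $u\in\mathcal{U}$ there is a unique maximally defined solution; it is called the solution below. Assume further: (R1) there are $\gamma\in\mathcal{K}_\infty$ and a non-decreasing $N:\mathbb{R}_{\ge 0}\to\mathbb{R}_{>0}$ such that $|f(t,\psi,\mu)|\le N(\|\psi\|)(1+\gamma(|\mu|))$ for all $t\ge 0$, $\psi\in\mathcal{C}$, $\mu\in\mathbb{R}^m$; (R2) for every $r>0$ and $\varepsilon>0$ there is $\delta>0$ such that $|f(t,\psi,\mu)-f(t,\psi,0)|<\varepsilon$ for all $t\ge 0$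 whenever $\|\psi\|\le r$ and $|\mu|\le\delta$; (R3) for every $r>0$ there is $L$ such that $|f(t,\psi,0)-f(t,\varphi,0)|\le L\|\psi-\varphi\|$ for all $t\ge 0$ whenever $\|\psi\|\le r$ and $\|\varphi\|\le r$. Stability notions. System (1) is - 0-GUAS if there is $\beta\in\mathcal{KL}$ such that for all $t_0\ge 0$ and $\psi\in\mathcal{C}$ the solution with zero input is defined for all $t\ge t_0$ and satisfies $|x(t)|\le\beta(\|\psi\|,t-t_0)$ for all $t\ge t_0$; - UBEBS with gain $\kappa\in\mathcal{K}_\infty$ if there are $\alpha_0,\rho\in\mathcal{K}_\infty$ and $c\ge 0$ such that for all $t_0\ge 0$, $\psi\in\mathcal{C}$ and $u\in\mathcal{U}$ the solution is defined for all $t\ge t_0$ and satisfies $|x(t)|\le\alpha_0(\|\psi\|)+\rho(\|u_{(t_0,t]}\|_\kappa)+c$ for all $t\ge t_0$; - iISS with gain $\kappa\in\mathcal{K}_\infty$ if there are $\beta\in\mathcal{KL}$ and $\rho\in\mathcal{K}_\infty$ such that for all $t_0\ge 0$, $\psi\in\mathcal{C}$ and $u\in\mathcal{U}$ the solution is defined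 for all $t\ge t_0$ and satisfies $|x(t)|\le\beta(\|\psi\|,t-t_0)+\rho(\|u_{(t_0,t]}\|_\kappa)$ for all $t\ge t_0$. Theorem. Let $\gamma\in\mathcal{K}_\infty$ be a function for which (R1) holds, and let (R2) and (R3) hold. Then: a) if system (1) is iISS with gain $\kappa$, then it is 0-GUAS and UBEBS with gain $\kappa$; b) if system (1) is 0-GUAS and UBEBS with gain $\alpha$, then it is iISS with gain $\max\{\alpha,\gamma\}$. -/

import Mathlib

open Set Filter Topology MeasureTheory
open scoped NNReal ENNReal

noncomputable section

namespace RetardedSystem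

/-! Comparison functions. -/

/-- Class `K`: continuous, strictly increasing and zero at zero. -/
structure IsClassK (α : ℝ≥0 → ℝ≥0) : Prop where
  continuous : Continuous α
  strictMono : StrictMono α
  map_zero : α 0 = 0

/-- Class `K∞`: class `K` and unbounded. -/
structure IsClassKInf (α : ℝ≥0 → ℝ≥0) : Prop extends IsClassK α where
  unbounded : ¬ BddAbove (range α)

/-- Class `KL`: `β (·, t)` is of class `K` for every `t`, and `β (r, ·)` decreases
monotonically to zero for every `r`. -/
structure IsClassKL (β : ℝ≥0 → ℝ≥0 → ℝ≥0) : Prop where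
  classK : ∀ t, IsClassK (fun r => β r t)
  antitone : ∀ r, Antitone (β r)
  tendsto_zero : ∀ r, Tendsto (β r) atTop (𝓝 0)

/-! History space, segments and inputs. -/

/-- The space `C([-τ, 0], ℝⁿ)` with the supremum norm (`ℝⁿ` carries the Euclidean norm). -/
abbrev History (τ : ℝ) (n : ℕ) : Type :=
  C(Icc (-τ) (0 : ℝ), EuclideanSpace ℝ (Fin n))

open Classical in
/-- The segment `x_t ∈ C([-τ, 0], ℝⁿ)`, `x_t(s) = x(t + s)`. The value `0` is used only when
`x` is not continuous on `[t - τ, t]`, which never happens along a solution. -/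
def segment {n : ℕ} (τ : ℝ) (x : ℝ → EuclideanSpace ℝ (Fin n)) (t : ℝ) : History τ n :=
  if h : Continuous (fun s : Icc (-τ) (0 : ℝ) => x (t + s)) then ⟨_, h⟩ else 0

theorem segment_apply {n : ℕ} {τ : ℝ} {x : ℝ → EuclideanSpace ℝ (Fin n)} {t : ℝ}
    (h : ContinuousOn x (Icc (t - τ) t)) (s : Icc (-τ) (0 : ℝ)) :
    segment τ x t s = x (t + s) := by
  have hc : Continuous (fun s : Icc (-τ) (0 : ℝ) => x (t + s)) := by
    refine h.comp_continuous (by fun_prop) (fun s => ?_)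
    have h1 := s.2.1
    have h2 := s.2.2
    constructor <;> linarith
  simp [segment, hc]

/-- An admissible input: a Lebesgue measurable, locally bounded function `[0, ∞) → ℝᵐ`.
Inputs are functions on `ℝ` of which only the values on `[0, ∞)` matter. -/
structure IsInput {m : ℕ} (u : ℝ → EuclideanSpace ℝ (Fin m)) : Prop where
  measurable : AEMeasurable u (volume.restrict (Ici 0))
  locallyBounded : ∀ T : ℝ, ∃ M : ℝ, ∀ t ∈ Icc 0 T, ‖u t‖ ≤ M

/-- The functional `‖u‖_κ = ∫₀^∞ κ(|u(s)|) ds ∈ [0, ∞]`. -/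
def energy {m : ℕ} (κ : ℝ≥0 → ℝ≥0) (u : ℝ → EuclideanSpace ℝ (Fin m)) : ℝ≥0∞ :=
  ∫⁻ s in Ici (0 : ℝ), (κ ‖u s‖₊ : ℝ≥0∞)

/-- `‖u_{(t₀, t]}‖_κ`, where `u_J` equals `u` on `J` and `0` elsewhere. It is finite for every
admissible input (`energy_indicator_lt_top`), so that `toNNReal` loses nothing. -/
def energyOn {m : ℕ} (κ : ℝ≥0 → ℝ≥0) (u : ℝ → EuclideanSpace ℝ (Fin m)) (t₀ t : ℝ) : ℝ≥0 :=
  (energy κ (indicator (Ioc t₀ t) u)).toNNReal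

theorem energy_indicator_lt_top {m : ℕ} {κ : ℝ≥0 → ℝ≥0} (hκ : IsClassK κ)
    {u : ℝ → EuclideanSpace ℝ (Fin m)} (hu : IsInput u) {t₀ t : ℝ} :
    energy κ (indicator (Ioc t₀ t) u) < ⊤ := by
  obtain ⟨M, hM⟩ := hu.locallyBounded t
  have hle : ∀ s ∈ Ici (0 : ℝ), (κ ‖indicator (Ioc t₀ t) u s‖₊ : ℝ≥0∞)
      ≤ indicator (Ioc t₀ t) (fun _ => (κ M.toNNReal : ℝ≥0∞)) s := by
    intro s hs
    by_cases h : s ∈ Ioc t₀ t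
    · simp only [indicator_of_mem h]
      refine ENNReal.coe_le_coe.2 (hκ.strictMono.monotone ?_)
      rw [← NNReal.coe_le_coe]
      exact (hM s ⟨hs, h.2⟩).trans (Real.le_coe_toNNReal M)
    · simp [indicator_of_notMem h, hκ.map_zero]
  calc energy κ (indicator (Ioc t₀ t) u)
      ≤ ∫⁻ s in Ici (0 : ℝ), indicator (Ioc t₀ t) (fun _ => (κ M.toNNReal : ℝ≥0∞)) s :=
        setLIntegral_mono' measurableSet_Ici hle
    _ ≤ ∫⁻ s, indicator (Ioc t₀ t) (fun _ => (κ M.toNNReal : ℝ≥0∞)) s :=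
        setLIntegral_le_lintegral _ _
    _ < ⊤ := by
        rw [lintegral_indicator measurableSet_Ioc, setLIntegral_const]
        exact ENNReal.mul_lt_top ENNReal.coe_lt_top (by simp)

/-! Solutions. The right-hand side `f` is used only at times `t ≥ 0`. -/

/-- The interval `[t₀ - τ, T)`, with `T ≤ ∞`. -/
def solDomain (τ t₀ : ℝ) (T : EReal) : Set ℝ :=
  {t | t₀ - τ ≤ t ∧ (t : EReal) < T}

/-- `x : [t₀ - τ, T) → ℝⁿ` is a solution of `ẋ(t) = f(t, x_t, u(t))` with `x_{t₀} = ψ`: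
it is continuous, locally absolutely continuous on `[t₀, T)`, and satisfies the equation for
almost every `t ∈ [t₀, T)`. -/
structure IsSolution {n m : ℕ} {τ : ℝ}
    (f : ℝ → History τ n → EuclideanSpace ℝ (Fin m) → EuclideanSpace ℝ (Fin n))
    (t₀ : ℝ) (ψ : History τ n) (u : ℝ → EuclideanSpace ℝ (Fin m))
    (T : EReal) (x : ℝ → EuclideanSpace ℝ (Fin n)) : Prop where
  lt_end : (t₀ : EReal) < T
  continuousOn : ContinuousOn x (solDomain τ t₀ T)
  initial : ∀ s : Icc (-τ) (0 : ℝ), x (t₀ + s) = ψ s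
  absolutelyContinuous : ∀ b : ℝ, t₀ ≤ b → (b : EReal) < T →
    AbsolutelyContinuousOnInterval x t₀ b
  equation : ∀ᵐ t : ℝ, t₀ ≤ t → (t : EReal) < T → HasDerivAt x (f t (segment τ x t) (u t)) t

/-- A maximally defined solution: no solution on a longer interval extends it. -/
structure IsMaximalSolution {n m : ℕ} {τ : ℝ}
    (f : ℝ → History τ n → EuclideanSpace ℝ (Fin m) → EuclideanSpace ℝ (Fin n))
    (t₀ : ℝ) (ψ : History τ n) (u : ℝ → EuclideanSpace ℝ (Fin m))
    (T : EReal) (x : ℝ → EuclideanSpace ℝ (Fin n)) : Prop where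
  isSolution : IsSolution f t₀ ψ u T x
  maximal : ∀ (T' : EReal) (y : ℝ → EuclideanSpace ℝ (Fin n)),
    T < T' → IsSolution f t₀ ψ u T' y → ¬ EqOn y x (solDomain τ t₀ T)

/-- The standing assumptions on `f : [0, ∞) × C × ℝᵐ → ℝⁿ`: continuity in `(ψ, μ)`, Lebesgue
measurability in `t`, and existence of a unique maximally defined solution for all initial
times, initial states and inputs. -/
structure StandingAssumptions {n m : ℕ} {τ : ℝ}
    (f : ℝ → History τ n → EuclideanSpace ℝ (Fin m) → EuclideanSpace ℝ (Fin n)) : Prop where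
  continuous : ∀ t : ℝ, 0 ≤ t →
    Continuous (fun p : History τ n × EuclideanSpace ℝ (Fin m) => f t p.1 p.2)
  measurable : ∀ (ψ : History τ n) (μ : EuclideanSpace ℝ (Fin m)),
    AEMeasurable (fun t => f t ψ μ) (volume.restrict (Ici 0))
  existsUnique : ∀ (t₀ : ℝ) (ψ : History τ n) (u : ℝ → EuclideanSpace ℝ (Fin m)),
    0 ≤ t₀ → IsInput u →
    ∃ (T : EReal) (x : ℝ → EuclideanSpace ℝ (Fin n)), IsMaximalSolution f t₀ ψ u T x ∧
      ∀ (T' : EReal) (y : ℝ → EuclideanSpace ℝ (Fin n)), IsMaximalSolution f t₀ ψ u T' y →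
        T' = T ∧ EqOn y x (solDomain τ t₀ T)

/-! The conditions (R1), (R2), (R3). -/

/-- Growth bound with gain `γ ∈ K∞`. -/
def ConditionR1 {n m : ℕ} {τ : ℝ}
    (f : ℝ → History τ n → EuclideanSpace ℝ (Fin m) → EuclideanSpace ℝ (Fin n))
    (γ : ℝ≥0 → ℝ≥0) : Prop :=
  IsClassKInf γ ∧ ∃ N : ℝ≥0 → ℝ≥0, (∀ r, 0 < N r) ∧ Monotone N ∧
    ∀ (t : ℝ) (ψ : History τ n) (μ : EuclideanSpace ℝ (Fin m)), 0 ≤ t →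
      ‖f t ψ μ‖₊ ≤ N ‖ψ‖₊ * (1 + γ ‖μ‖₊)

/-- Continuity in the input at zero input, uniform in time and on bounded sets of states. -/
def ConditionR2 {n m : ℕ} {τ : ℝ}
    (f : ℝ → History τ n → EuclideanSpace ℝ (Fin m) → EuclideanSpace ℝ (Fin n)) : Prop :=
  ∀ r ε : ℝ, 0 < r → 0 < ε → ∃ δ : ℝ, 0 < δ ∧
    ∀ (t : ℝ) (ψ : History τ n) (μ : EuclideanSpace ℝ (Fin m)), 0 ≤ t → ‖ψ‖ ≤ r → ‖μ‖ ≤ δ →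
      ‖f t ψ μ - f t ψ 0‖ < ε

/-- At zero input, Lipschitz in the state on bounded sets, uniformly in time. -/
def ConditionR3 {n m : ℕ} {τ : ℝ}
    (f : ℝ → History τ n → EuclideanSpace ℝ (Fin m) → EuclideanSpace ℝ (Fin n)) : Prop :=
  ∀ r : ℝ, 0 < r → ∃ L : ℝ, ∀ (t : ℝ) (ψ φ : History τ n), 0 ≤ t → ‖ψ‖ ≤ r → ‖φ‖ ≤ r →
    ‖f t ψ 0 - f t φ 0‖ ≤ L * ‖ψ - φ‖

/-! Stability notions. A bound for all `t ≥ t₀` includes that the solution is defined for all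
`t ≥ t₀`, that is `T = ⊤`. -/

/-- Zero-input global uniform asymptotic stability. -/
def ZeroGUAS {n m : ℕ} {τ : ℝ}
    (f : ℝ → History τ n → EuclideanSpace ℝ (Fin m) → EuclideanSpace ℝ (Fin n)) : Prop :=
  ∃ β : ℝ≥0 → ℝ≥0 → ℝ≥0, IsClassKL β ∧
    ∀ (t₀ : ℝ) (ψ : History τ n) (T : EReal) (x : ℝ → EuclideanSpace ℝ (Fin n)), 0 ≤ t₀ →
      IsMaximalSolution f t₀ ψ (fun _ => 0) T x →
      T = ⊤ ∧ ∀ t : ℝ, t₀ ≤ t → ‖x t‖₊ ≤ β ‖ψ‖₊ (t - t₀).toNNReal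

/-- Uniformly bounded-energy input / bounded state, with gain `κ`. -/
def UBEBSWithGain {n m : ℕ} {τ : ℝ}
    (f : ℝ → History τ n → EuclideanSpace ℝ (Fin m) → EuclideanSpace ℝ (Fin n))
    (κ : ℝ≥0 → ℝ≥0) : Prop :=
  IsClassKInf κ ∧ ∃ (α ρ : ℝ≥0 → ℝ≥0) (c : ℝ≥0), IsClassKInf α ∧ IsClassKInf ρ ∧
    ∀ (t₀ : ℝ) (ψ : History τ n) (u : ℝ → EuclideanSpace ℝ (Fin m))
      (T : EReal) (x : ℝ → EuclideanSpace ℝ (Fin n)), 0 ≤ t₀ → IsInput u →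
      IsMaximalSolution f t₀ ψ u T x →
      T = ⊤ ∧ ∀ t : ℝ, t₀ ≤ t → ‖x t‖₊ ≤ α ‖ψ‖₊ + ρ (energyOn κ u t₀ t) + c

/-- Integral input-to-state stability with gain `κ`. -/
def IISSWithGain {n m : ℕ} {τ : ℝ}
    (f : ℝ → History τ n → EuclideanSpace ℝ (Fin m) → EuclideanSpace ℝ (Fin n))
    (κ : ℝ≥0 → ℝ≥0) : Prop :=
  IsClassKInf κ ∧ ∃ (β : ℝ≥0 → ℝ≥0 → ℝ≥0) (ρ : ℝ≥0 → ℝ≥0), IsClassKL β ∧ IsClassKInf ρ ∧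
    ∀ (t₀ : ℝ) (ψ : History τ n) (u : ℝ → EuclideanSpace ℝ (Fin m))
      (T : EReal) (x : ℝ → EuclideanSpace ℝ (Fin n)), 0 ≤ t₀ → IsInput u →
      IsMaximalSolution f t₀ ψ u T x →
      T = ⊤ ∧ ∀ t : ℝ, t₀ ≤ t → ‖x t‖₊ ≤ β ‖ψ‖₊ (t - t₀).toNNReal + ρ (energyOn κ u t₀ t)

end RetardedSystem

end

noncomputable section

namespace RetardedSystem

/-! ### Comparison functions dominating monotone functions -/

/-! Part a) is direct: zero input has zero energy, which gives 0-GUAS, and `β r t ≤ β r 0` gives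
UBEBS with `c = 0`.

For part b) put `κ = max α γ`. The analytic core is tracking (`IsSolution.norm_sub_le`,
`exists_norm_le_add_of_energyOn_le`): in a fixed ball and over a bounded time, a solution whose
input has small `γ`-energy stays close to the zero-input solution with the same initial state, by
Grönwall. The zero-input solution decays by 0-GUAS, so after a suitable period a low-energy input
has driven the whole segment into a small ball (`exists_period_norm_segment_le`).

Together with the boundedness from UBEBS this has two consequences. A small ball is mapped into
itself period after period, so small data give small solutions for all time
(`exists_norm_le_of_small`). And if the total energy is bounded, then among sufficiently many
periods one has low energy, so every ball is reached within a uniform time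
(`exists_time_norm_segment_le`).

Boundedness, smallness and attraction are turned into an estimate `β + ρ` by
`exists_isClassKL_add_isClassKInf_ge`, which involves no dynamics: `ρ` majorizes the largest value
`g` attainable from given size and energy, and `β` majorizes the excess over `g e`. -/

theorem tendsto_zero_of_eventually_le {ι : Type*} {l : Filter ι} {F : ι → ℝ≥0}
    (h : ∀ ε, 0 < ε → ∀ᶠ x in l, F x ≤ ε) : Tendsto F l (𝓝 0) := by
  refine tendsto_order.2 ⟨fun a ha => absurd ha not_lt_zero, fun a ha => ?_⟩
  obtain ⟨ε, hε, hεa⟩ := exists_between ha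
  exact (h ε hε).mono fun x hx => hx.trans_lt hεa

/-- The mean of `b` over `[r, 2r]`, a continuous majorant of a monotone function `b`. -/
def dilationMean (b : ℝ≥0 → ℝ≥0) (r : ℝ≥0) : ℝ≥0 :=
  (∫ σ in (1 : ℝ)..2, (b (r * σ.toNNReal) : ℝ)).toNNReal

section DilationMean

variable {b c : ℝ≥0 → ℝ≥0}

theorem intervalIntegrable_dilation (hb : Monotone b) (r : ℝ≥0) (p q : ℝ) :
    IntervalIntegrable (fun σ : ℝ => (b (r * σ.toNNReal) : ℝ)) volume p q :=
  Monotone.intervalIntegrable fun σ σ' h => by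
    have : σ.toNNReal ≤ σ'.toNNReal := Real.toNNReal_mono h
    exact NNReal.coe_le_coe.2 (hb (by gcongr))

theorem coe_dilationMean (b : ℝ≥0 → ℝ≥0) (r : ℝ≥0) :
    (dilationMean b r : ℝ) = ∫ σ in (1 : ℝ)..2, (b (r * σ.toNNReal) : ℝ) :=
  Real.coe_toNNReal _ (intervalIntegral.integral_nonneg (by norm_num) fun _ _ => NNReal.coe_nonneg _)

theorem dilationMean_mono_left (hb : Monotone b) (hc : Monotone c) (h : ∀ r, b r ≤ c r)
    (r : ℝ≥0) : dilationMean b r ≤ dilationMean c r := by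
  rw [← NNReal.coe_le_coe, coe_dilationMean, coe_dilationMean]
  exact intervalIntegral.integral_mono (by norm_num) (intervalIntegrable_dilation hb r 1 2)
    (intervalIntegrable_dilation hc r 1 2) fun _ => NNReal.coe_le_coe.2 (h _)

theorem monotone_dilationMean (hb : Monotone b) : Monotone (dilationMean b) := by
  intro r r' h
  rw [← NNReal.coe_le_coe, coe_dilationMean, coe_dilationMean]
  exact intervalIntegral.integral_mono (by norm_num) (intervalIntegrable_dilation hb r 1 2)
    (intervalIntegrable_dilation hb r' 1 2) fun _ => NNReal.coe_le_coe.2 (hb (by gcongr))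

theorem le_dilationMean (hb : Monotone b) (r : ℝ≥0) : b r ≤ dilationMean b r := by
  rw [← NNReal.coe_le_coe, coe_dilationMean]
  have h := intervalIntegral.integral_mono_on (by norm_num : (1 : ℝ) ≤ 2)
    (intervalIntegrable_const (c := (b r : ℝ))) (intervalIntegrable_dilation hb r 1 2)
    fun σ hσ => by
      refine NNReal.coe_le_coe.2 (hb ?_)
      have : (1 : ℝ≥0) ≤ σ.toNNReal := by simpa using hσ.1
      exact le_mul_of_one_le_right' this
  rw [intervalIntegral.integral_const] at h
  norm_num at h
  exact h

theorem dilationMean_le (hb : Monotone b) (r : ℝ≥0) : dilationMean b r ≤ b (r * 2) := by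
  rw [← NNReal.coe_le_coe, coe_dilationMean]
  have h := intervalIntegral.integral_mono_on (by norm_num : (1 : ℝ) ≤ 2)
    (intervalIntegrable_dilation hb r 1 2) (intervalIntegrable_const (c := (b (r * 2) : ℝ)))
    fun σ hσ => by
      refine NNReal.coe_le_coe.2 (hb ?_)
      have : σ.toNNReal ≤ 2 := by simpa using hσ.2
      gcongr
  rw [intervalIntegral.integral_const] at h
  norm_num at h
  exact h

theorem dilationMean_zero (hb : Monotone b) (h0 : b 0 = 0) : dilationMean b 0 = 0 := by
  simpa [h0] using dilationMean_le hb 0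

/-- For `r ≠ 0` a change of variables turns the mean into `r⁻¹ ∫ b` over `[r, 2r]`, a quotient
involving a continuous primitive, even if `b` jumps. At `0` it is squeezed by `b (r * 2)`. -/
theorem continuous_dilationMean (hb : Monotone b) (h0 : Tendsto b (𝓝 0) (𝓝 0)) :
    Continuous (dilationMean b) := by
  have hb0 : b 0 = 0 := eq_of_tendsto_nhds h0
  rw [continuous_iff_continuousAt]
  intro r
  rcases eq_or_ne r 0 with rfl | hr
  · rw [ContinuousAt, dilationMean_zero hb hb0]
    have h2 : Tendsto (fun r : ℝ≥0 => b (r * 2)) (𝓝 0) (𝓝 0) := by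
      refine h0.comp ?_
      have : Continuous fun r : ℝ≥0 => r * 2 := by fun_prop
      simpa using this.tendsto 0
    exact tendsto_of_tendsto_of_tendsto_of_le_of_le tendsto_const_nhds h2
      (fun _ => zero_le) (dilationMean_le hb)
  · set F : ℝ → ℝ := fun x => ∫ s in (0 : ℝ)..x, (b s.toNNReal : ℝ)
    have hint : ∀ p q : ℝ, IntervalIntegrable (fun s : ℝ => (b s.toNNReal : ℝ)) volume p q := by
      intro p q
      simpa using intervalIntegrable_dilation hb 1 p q
    have hF : Continuous F := intervalIntegral.continuous_primitive hint 0
    have hev : ∀ᶠ r' : ℝ≥0 in 𝓝 r,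
        Real.toNNReal ((r' : ℝ)⁻¹ * (F (r' * 2) - F r')) = dilationMean b r' := by
      filter_upwards [isOpen_ne.mem_nhds hr] with r' hr'
      have hr'' : (r' : ℝ) ≠ 0 := NNReal.coe_ne_zero.2 hr'
      have h1 := intervalIntegral.integral_comp_mul_left (a := 1) (b := 2)
        (fun s : ℝ => (b s.toNNReal : ℝ)) hr''
      rw [intervalIntegral.integral_interval_sub_left (hint _ _) (hint _ _)]
      rw [smul_eq_mul, mul_one] at h1
      rw [← h1, dilationMean]
      congr 2
      ext σ
      rw [Real.toNNReal_mul r'.coe_nonneg, Real.toNNReal_coe]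
    refine ContinuousAt.congr ?_ hev
    refine (continuous_real_toNNReal.continuousAt).comp ?_
    refine ContinuousAt.mul ?_ ?_
    · exact (NNReal.continuous_coe.continuousAt).inv₀ (NNReal.coe_ne_zero.2 hr)
    · exact (by fun_prop : Continuous fun r' : ℝ≥0 => F (r' * 2) - F r').continuousAt

/-- Averaging yields continuity but only weak monotonicity; the linear term supplies strictness. The
slope `k` is free so that it can be `1` for class `K∞` and decay in time for class `KL`. -/
theorem isClassK_dilationMean_add (hb : Monotone b) (h0 : Tendsto b (𝓝 0) (𝓝 0)) {k : ℝ≥0}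
    (hk : 0 < k) : IsClassK fun r => dilationMean b r + r * k where
  continuous := (continuous_dilationMean hb h0).add (by fun_prop)
  strictMono := (monotone_dilationMean hb).add_strictMono fun _ _ h =>
    mul_lt_mul_of_pos_right h hk
  map_zero := by simp [dilationMean_zero hb (eq_of_tendsto_nhds h0)]

end DilationMean

theorem IsClassKInf.of_le {a : ℝ≥0 → ℝ≥0} (ha : IsClassK a) (h : ∀ r, r ≤ a r) :
    IsClassKInf a where
  toIsClassK := ha
  unbounded := by
    rintro ⟨M, hM⟩
    have h1 : a (M + 1) ≤ M := hM ⟨_, rfl⟩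
    exact absurd ((h (M + 1)).trans h1) (by simp)

/-- A monotone function vanishing continuously at zero has a class `K∞` majorant. -/
theorem exists_isClassKInf_ge {g : ℝ≥0 → ℝ≥0} (hg : Monotone g) (h0 : Tendsto g (𝓝 0) (𝓝 0)) :
    ∃ ρ, IsClassKInf ρ ∧ ∀ r, g r ≤ ρ r :=
  ⟨fun r => dilationMean g r + r * 1,
    .of_le (isClassK_dilationMean_add hg h0 one_pos) fun r => by simp,
    fun r => (le_dilationMean hg r).trans (by simp)⟩

/-- Majorants of class `KL`. -/
theorem exists_isClassKL_ge {B : ℝ≥0 → ℝ≥0 → ℝ≥0} {g : ℝ≥0 → ℝ≥0}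
    (hmono : ∀ t, Monotone fun r => B r t) (hanti : ∀ r, Antitone (B r))
    (hlim : ∀ r, Tendsto (B r) atTop (𝓝 0)) (hBg : ∀ r t, B r t ≤ g r)
    (h0 : Tendsto g (𝓝 0) (𝓝 0)) :
    ∃ β, IsClassKL β ∧ ∀ r t, B r t ≤ β r t := by
  have hB0 : ∀ t, Tendsto (fun r => B r t) (𝓝 0) (𝓝 0) := fun t =>
    tendsto_of_tendsto_of_tendsto_of_le_of_le tendsto_const_nhds h0 (fun _ => zero_le)
      fun r => hBg r t
  -- The slope `(1 + t)⁻¹` is positive for each `t`, hence strict growth in `r`, and vanishes as `t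
  -- → ∞`.
  refine ⟨fun r t => dilationMean (fun r => B r t) r + r * (1 + t)⁻¹, ⟨?_, ?_, ?_⟩, ?_⟩
  · exact fun t => isClassK_dilationMean_add (hmono t) (hB0 t) (by positivity)
  · intro r t t' h
    have h1 : dilationMean (fun r => B r t') r ≤ dilationMean (fun r => B r t) r :=
      dilationMean_mono_left (hmono t') (hmono t) (fun r => hanti r h) r
    have h2 : (1 + t')⁻¹ ≤ (1 + t)⁻¹ := inv_anti₀ (by positivity) (by gcongr)
    dsimp only
    gcongr
  · intro r
    have h1 : Tendsto (fun t => dilationMean (fun r => B r t) r) atTop (𝓝 0) :=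
      tendsto_of_tendsto_of_tendsto_of_le_of_le tendsto_const_nhds (hlim (r * 2))
        (fun _ => zero_le) fun t => dilationMean_le (hmono t) r
    have h2 : Tendsto (fun t : ℝ≥0 => r * (1 + t)⁻¹) atTop (𝓝 0) := by
      refine tendsto_zero_of_eventually_le fun ε hε => ?_
      filter_upwards [eventually_ge_atTop (r / ε)] with t ht
      rw [← div_eq_mul_inv, div_le_iff₀ (by positivity)]
      calc r = ε * (r / ε) := (mul_div_cancel₀ r hε.ne').symm
        _ ≤ ε * (1 + t) := by gcongr; exact ht.trans le_add_self
    simpa using h1.add h2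
  · exact fun r t => (le_dilationMean (hmono t) r).trans (by simp)

/-- A family of values `v`, indexed by a size `r`, an energy `e` and a time `t`, that is bounded on
bounded sets, small for small `r` and `e`, and that for large `t` is attained from small `r`, is
bounded by the sum of a class `KL` function of `(r, t)` and a class `K∞` function of `e`. -/
theorem exists_isClassKL_add_isClassKInf_ge {Q : ℝ≥0 → ℝ≥0 → ℝ≥0 → ℝ≥0 → Prop}
    (hbdd : ∀ r, ∃ M, ∀ r' e t v, r' ≤ r → e ≤ r → Q r' e t v → v ≤ M)
    (hsmall : ∀ ε, 0 < ε → ∃ δ, 0 < δ ∧ ∀ r e t v, r ≤ δ → e ≤ δ → Q r e t v → v ≤ ε)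
    (hattr : ∀ r ε, 0 < ε → ∃ T, ∀ r' e t v, r' ≤ r → e ≤ r → T ≤ t → Q r' e t v →
      ∃ r'' e'' t'', r'' ≤ ε ∧ e'' ≤ e ∧ Q r'' e'' t'' v) :
    ∃ β ρ, IsClassKL β ∧ IsClassKInf ρ ∧ ∀ r e t v, Q r e t v → v ≤ β r t + ρ e := by
  set G : ℝ≥0 → Set ℝ≥0 := fun s => {v | ∃ r e t, r ≤ s ∧ e ≤ s ∧ Q r e t v}
  set g : ℝ≥0 → ℝ≥0 := fun s => sSup (G s)
  have hGb : ∀ s, BddAbove (G s) := fun s => by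
    obtain ⟨M, hM⟩ := hbdd s
    exact ⟨M, fun v ⟨r, e, t, hr, he, h⟩ => hM r e t v hr he h⟩
  have hle : ∀ {s r e t v}, r ≤ s → e ≤ s → Q r e t v → v ≤ g s := fun hr he h =>
    le_csSup (hGb _) ⟨_, _, _, hr, he, h⟩
  have hg : Monotone g := fun s s' h => csSup_le_csSup' (hGb s')
    fun v ⟨r, e, t, hr, he, hQ⟩ => ⟨r, e, t, hr.trans h, he.trans h, hQ⟩
  have hgε : ∀ ε, 0 < ε → ∃ δ, 0 < δ ∧ g δ ≤ ε := fun ε hε => by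
    obtain ⟨δ, hδ, h⟩ := hsmall ε hε
    exact ⟨δ, hδ, csSup_le' fun v ⟨r, e, t, hr, he, hQ⟩ => h r e t v hr he hQ⟩
  have hg0 : Tendsto g (𝓝 0) (𝓝 0) := by
    refine tendsto_zero_of_eventually_le fun ε hε => ?_
    obtain ⟨δ, hδ, h⟩ := hgε ε hε
    filter_upwards [gt_mem_nhds hδ] with s hs using (hg hs.le).trans h
  -- Excesses over `g e`, with truncated subtraction. Admitting all times `t' ≥ t` makes the
  -- supremum antitone in `t`.
  set D : ℝ≥0 → ℝ≥0 → Set ℝ≥0 := fun r t =>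
    {w | ∃ r' e t' v, r' ≤ r ∧ t ≤ t' ∧ Q r' e t' v ∧ w = v - g e}
  have hDg : ∀ r t, g r ∈ upperBounds (D r t) := by
    rintro r t _ ⟨r', e, t', v, hr, -, hQ, rfl⟩
    rcases le_total e r with he | he
    · exact tsub_le_self.trans (hle hr he hQ)
    · rw [tsub_eq_zero_of_le (hle (hr.trans he) le_rfl hQ)]
      exact zero_le
  have hDb : ∀ r t, BddAbove (D r t) := fun r t => ⟨_, hDg r t⟩
  obtain ⟨ρ, hρ, hgρ⟩ := exists_isClassKInf_ge hg hg0
  obtain ⟨β, hβ, hBβ⟩ := exists_isClassKL_ge (B := fun r t => sSup (D r t)) (g := g)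
    (fun t r r' h => csSup_le_csSup' (hDb _ _)
      fun w ⟨r₁, e, t', v, hr, ht, hQ⟩ => ⟨r₁, e, t', v, hr.trans h, ht, hQ⟩)
    (fun r t t' h => csSup_le_csSup' (hDb _ _)
      fun w ⟨r₁, e, t₁, v, hr, ht, hQ⟩ => ⟨r₁, e, t₁, v, hr, h.trans ht, hQ⟩)
    (fun r => by
      refine tendsto_zero_of_eventually_le fun ε hε => ?_
      obtain ⟨δ, hδ, hgδ⟩ := hgε ε hε
      obtain ⟨T, hT⟩ := hattr r δ hδ
      filter_upwards [eventually_ge_atTop T] with t ht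
      refine csSup_le' ?_
      rintro _ ⟨r', e, t', v, hr, ht', hQ, rfl⟩
      -- If `e ≥ r ≥ r'`, then `v ≤ g e` and the excess is zero. Only energies `e ≤ r` remain, where
      -- the attraction time is uniform; there `v ≤ g (max δ e) = max (g δ) (g e)`, so the excess is
      -- at most `g δ ≤ ε`.
      rcases le_total e r with he | he
      · obtain ⟨r'', e'', t'', hr'', he'', hQ''⟩ := hT r' e t' v hr he (ht.trans ht') hQ
        have hv : v ≤ g (max δ e) :=
          hle (hr''.trans (le_max_left _ _)) (he''.trans (le_max_right _ _)) hQ''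
        rw [hg.map_max] at hv
        rw [tsub_le_iff_right]
        exact hv.trans (max_le (hgδ.trans le_self_add) le_add_self)
      · rw [tsub_eq_zero_of_le (hle (hr.trans he) le_rfl hQ)]
        exact zero_le)
    (fun r t => csSup_le' (hDg r t)) hg0
  refine ⟨β, ρ, hβ, hρ, fun r e t v hQ => ?_⟩
  have h1 : v - g e ≤ sSup (D r t) := le_csSup (hDb r t) ⟨r, e, t, v, le_rfl, le_rfl, hQ, rfl⟩
  exact (tsub_le_iff_right.1 (h1.trans (hBβ r t))).trans (by gcongr; exact hgρ e)

/-! ### Integral inequalities -/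

/-- The increment of an absolutely continuous function is bounded by the integral of a bound on
the norm of its derivative. -/
theorem _root_.AbsolutelyContinuousOnInterval.norm_sub_le_integral {E : Type*}
    [NormedAddCommGroup E] [NormedSpace ℝ E] {y : ℝ → E} {h : ℝ → ℝ} {a b : ℝ} (hab : a ≤ b)
    (hy : AbsolutelyContinuousOnInterval y a b) (hh : IntervalIntegrable h volume a b)
    (hd : ∀ᵐ t, t ∈ Ioo a b → ∃ y', HasDerivAt y y' t ∧ ‖y'‖ ≤ h t) :
    ‖y b - y a‖ ≤ ∫ t in a..b, h t := by
  -- A norming functional of the increment reduces the claim to the fundamental theorem of calculus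
  -- for a real function.
  obtain ⟨g, hg1, hg⟩ := exists_dual_vector'' ℝ (y b - y a)
  have hac : AbsolutelyContinuousOnInterval (fun t => g (y t)) a b := by
    rw [absolutelyContinuousOnInterval_iff] at hy ⊢
    intro ε hε
    obtain ⟨δ, hδ, H⟩ := hy ε hε
    refine ⟨δ, hδ, fun I hI hI' => (Finset.sum_le_sum fun i _ => ?_).trans_lt (H I hI hI')⟩
    rw [dist_eq_norm, dist_eq_norm, ← map_sub]
    exact g.le_of_opNorm_le_of_le hg1 le_rfl |>.trans (by simp)
  have hle : ∫ t in a..b, deriv (fun t => g (y t)) t ≤ ∫ t in a..b, h t := by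
    refine intervalIntegral.integral_mono_ae_restrict hab hac.intervalIntegrable_deriv hh ?_
    rw [← restrict_Ioo_eq_restrict_Icc, EventuallyLE, ae_restrict_iff' measurableSet_Ioo]
    filter_upwards [hd] with t ht htab
    obtain ⟨y', hy', hle⟩ := ht htab
    have hg' : HasDerivAt (fun t => g (y t)) (g y') t := g.hasFDerivAt.comp_hasDerivAt t hy'
    rw [hg'.deriv]
    calc g y' ≤ ‖g y'‖ := Real.le_norm_self _
      _ ≤ 1 * ‖y'‖ := g.le_of_opNorm_le hg1 y'
      _ ≤ h t := by rwa [one_mul]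
  rw [hac.integral_deriv_eq_sub, ← map_sub, hg] at hle
  exact hle

/-- A Grönwall lemma: a continuous function that is dominated by `a + M (exp (L (t - t₀)) - 1)` as
soon as it is dominated by `M exp (L (s - t₀))` at all earlier times is dominated by
`a exp (L (t - t₀))`. -/
theorem le_mul_exp_of_forall_le {D : ℝ → ℝ} {a L t₀ t₁ : ℝ} (ha : 0 ≤ a)
    (hD : ContinuousOn D (Icc t₀ t₁))
    (H : ∀ t ∈ Icc t₀ t₁, ∀ M, 0 ≤ M → (∀ s ∈ Ico t₀ t, D s ≤ M * Real.exp (L * (s - t₀))) →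
      D t ≤ a + M * (Real.exp (L * (t - t₀)) - 1)) :
    ∀ t ∈ Icc t₀ t₁, D t ≤ a * Real.exp (L * (t - t₀)) := by
  -- At the first time where `D` reaches `a' exp`, the hypothesis with `M = a'` gives `D ≤ a' exp -
  -- (a' - a)`, a contradiction. The strict inequality `a < a'` is removed by a limit at the end.
  have key : ∀ a', a < a' → ∀ t ∈ Icc t₀ t₁, D t ≤ a' * Real.exp (L * (t - t₀)) := by
    intro a' haa' t ht
    by_contra! hlt
    set F : ℝ → ℝ := fun t => D t - a' * Real.exp (L * (t - t₀))
    have hF : ContinuousOn F (Icc t₀ t₁) := hD.sub (by fun_prop)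
    have hcl : IsClosed (Icc t₀ t₁ ∩ F ⁻¹' Ici 0) := hF.preimage_isClosed_of_isClosed isClosed_Icc
      isClosed_Ici
    have hcomp : IsCompact (Icc t₀ t₁ ∩ F ⁻¹' Ici 0) :=
      isCompact_Icc.of_isClosed_subset hcl inter_subset_left
    obtain ⟨s, ⟨hs, hFs⟩, hmin⟩ := hcomp.exists_isLeast ⟨t, ht, (sub_pos.2 hlt).le⟩
    have h1 := H s hs a' (ha.trans haa'.le) fun σ hσ => by
      by_contra! hlt'
      exact absurd (hmin ⟨⟨hσ.1, hσ.2.le.trans hs.2⟩, (sub_pos.2 hlt').le⟩) (not_le.2 hσ.2)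
    have h2 : 0 ≤ D s - a' * Real.exp (L * (s - t₀)) := hFs
    linarith
  intro t ht
  have hc : ContinuousWithinAt (fun a' => a' * Real.exp (L * (t - t₀))) (Ioi a) a := by fun_prop
  exact ge_of_tendsto hc (eventually_mem_nhdsWithin.mono fun a' ha' => key a' ha' t ht)

/-! ### The energy of an input -/

section Energy

variable {m : ℕ} {κ κ' : ℝ≥0 → ℝ≥0} {u : ℝ → EuclideanSpace ℝ (Fin m)} {a b c : ℝ}

theorem IsClassK.intervalIntegrable (hκ : IsClassK κ) (hu : IsInput u) (ha : 0 ≤ a) (hb : 0 ≤ b) :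
    IntervalIntegrable (fun s => (κ ‖u s‖₊ : ℝ)) volume a b := by
  obtain ⟨M, hM⟩ := hu.locallyBounded (max a b)
  have hsub : uIoc a b ⊆ Ici 0 := fun s hs => (le_min ha hb).trans hs.1.le
  rw [intervalIntegrable_iff]
  refine IntegrableOn.of_bound (by simp) ?_ (κ M.toNNReal : ℝ) ?_
  · have h1 : AEMeasurable u (volume.restrict (uIoc a b)) :=
      hu.measurable.mono_measure (Measure.restrict_mono hsub le_rfl)
    have h2 : Measurable fun v : EuclideanSpace ℝ (Fin m) => (κ ‖v‖₊ : ℝ) :=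
      (NNReal.continuous_coe.comp (hκ.continuous.comp continuous_nnnorm)).measurable
    exact (h2.comp_aemeasurable h1).aestronglyMeasurable
  · refine (ae_restrict_iff' measurableSet_uIoc).2 (ae_of_all _ fun s hs => ?_)
    rw [Real.norm_of_nonneg (NNReal.coe_nonneg _), NNReal.coe_le_coe]
    refine hκ.strictMono.monotone ?_
    rw [← NNReal.coe_le_coe]
    exact (hM s ⟨hsub hs, hs.2⟩).trans (Real.le_coe_toNNReal M)

theorem coe_energyOn (hκ : IsClassK κ) (hu : IsInput u) (ha : 0 ≤ a) (hab : a ≤ b) :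
    (energyOn κ u a b : ℝ) = ∫ s in a..b, (κ ‖u s‖₊ : ℝ) := by
  have h0 : energy κ (indicator (Ioc a b) u) = ∫⁻ s in Ioc a b, (κ ‖u s‖₊ : ℝ≥0∞) := by
    have : ∀ s, (κ ‖indicator (Ioc a b) u s‖₊ : ℝ≥0∞)
        = indicator (Ioc a b) (fun s => (κ ‖u s‖₊ : ℝ≥0∞)) s := fun s => by
      by_cases h : s ∈ Ioc a b <;> simp [h, hκ.map_zero]
    simp only [energy, this]
    rw [setLIntegral_indicator measurableSet_Ioc,
      inter_eq_left.2 fun s hs => mem_Ici.2 (ha.trans hs.1.le)]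
  have hint := (intervalIntegrable_iff_integrableOn_Ioc_of_le hab).1
    (hκ.intervalIntegrable hu ha (ha.trans hab))
  rw [intervalIntegral.integral_of_le hab, integral_eq_lintegral_of_nonneg_ae
    (ae_of_all _ fun _ => NNReal.coe_nonneg _) hint.aestronglyMeasurable, energyOn, h0]
  simp [ENNReal.toReal]

theorem energyOn_add (hκ : IsClassK κ) (hu : IsInput u) (ha : 0 ≤ a) (hab : a ≤ b) (hbc : b ≤ c) :
    energyOn κ u a b + energyOn κ u b c = energyOn κ u a c := by
  rw [← NNReal.coe_inj, NNReal.coe_add, coe_energyOn hκ hu ha hab,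
    coe_energyOn hκ hu (ha.trans hab) hbc, coe_energyOn hκ hu ha (hab.trans hbc)]
  exact intervalIntegral.integral_add_adjacent_intervals
    (hκ.intervalIntegrable hu ha (ha.trans hab))
    (hκ.intervalIntegrable hu (ha.trans hab) (ha.trans (hab.trans hbc)))

theorem energyOn_le_energyOn (hκ : IsClassK κ) (hu : IsInput u) {a' b' : ℝ} (ha : 0 ≤ a)
    (haa' : a ≤ a') (hab' : a' ≤ b') (hbb' : b' ≤ b) :
    energyOn κ u a' b' ≤ energyOn κ u a b := by
  rw [← energyOn_add hκ hu ha haa' (hab'.trans hbb'),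
    ← energyOn_add hκ hu (ha.trans haa') hab' hbb']
  exact le_self_add.trans le_add_self

theorem energyOn_mono_left (hκ' : IsClassK κ') (hu : IsInput u) (h : ∀ r, κ r ≤ κ' r) (a b : ℝ) :
    energyOn κ u a b ≤ energyOn κ' u a b :=
  ENNReal.toNNReal_mono (energy_indicator_lt_top hκ' hu).ne
    (lintegral_mono fun _ => ENNReal.coe_le_coe.2 (h _))

theorem isInput_zero : IsInput (fun _ => 0 : ℝ → EuclideanSpace ℝ (Fin m)) :=
  ⟨aemeasurable_const, fun _ => ⟨0, by simp⟩⟩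

theorem energyOn_zero (hκ : IsClassK κ) (a b : ℝ) :
    energyOn κ (fun _ => 0 : ℝ → EuclideanSpace ℝ (Fin m)) a b = 0 := by
  simp [energyOn, energy, hκ.map_zero]

/-- Contrapositively a pigeonhole principle: if the total energy is less than `k • δ`, some period
has energy below `δ`. -/
theorem nsmul_le_energyOn (hκ : IsClassK κ) (hu : IsInput u) (ha : 0 ≤ a) {p : ℝ} (hp : 0 ≤ p)
    {δ : ℝ≥0} (k : ℕ) (h : ∀ j < k, δ ≤ energyOn κ u (a + j * p) (a + (j + 1) * p)) :
    k • δ ≤ energyOn κ u a (a + k * p) := by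
  induction k with
  | zero => simp
  | succ k ih =>
    have hk : a ≤ a + k * p := le_add_of_nonneg_right (by positivity)
    push_cast
    rw [← energyOn_add hκ hu ha hk (by nlinarith), succ_nsmul]
    exact add_le_add (ih fun j hj => h j (hj.trans k.lt_succ_self)) (h k k.lt_succ_self)

end Energy

/-! ### Segments of globally defined solutions -/

section Solutions

variable {n m : ℕ} {τ : ℝ}
  {f : ℝ → History τ n → EuclideanSpace ℝ (Fin m) → EuclideanSpace ℝ (Fin n)}
  {t₀ : ℝ} {ψ : History τ n} {u : ℝ → EuclideanSpace ℝ (Fin m)} {x z : ℝ → EuclideanSpace ℝ (Fin n)}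

theorem norm_segment_le {t R : ℝ} (hR : 0 ≤ R) (hx : ContinuousOn x (Icc (t - τ) t))
    (h : ∀ s ∈ Icc (t - τ) t, ‖x s‖ ≤ R) : ‖segment τ x t‖ ≤ R := by
  refine (ContinuousMap.norm_le _ hR).2 fun s => ?_
  rw [segment_apply hx]
  have h1 := s.2.1
  have h2 := s.2.2
  exact h _ ⟨by linarith, by linarith⟩

theorem IsSolution.isMaximalSolution (hx : IsSolution f t₀ ψ u ⊤ x) :
    IsMaximalSolution f t₀ ψ u ⊤ x :=
  ⟨hx, fun _ _ h => absurd h not_top_lt⟩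

theorem IsSolution.continuousOn_Icc (hx : IsSolution f t₀ ψ u ⊤ x) {a : ℝ} (ha : t₀ - τ ≤ a)
    (b : ℝ) : ContinuousOn x (Icc a b) :=
  hx.continuousOn.mono fun _ ht => ⟨ha.trans ht.1, EReal.coe_lt_top _⟩

theorem IsSolution.norm_le_of_le (hx : IsSolution f t₀ ψ u ⊤ x) {s : ℝ} (h1 : t₀ - τ ≤ s)
    (h2 : s ≤ t₀) : ‖x s‖ ≤ ‖ψ‖ := by
  have h := hx.initial ⟨s - t₀, by linarith, by linarith⟩
  simp only [add_sub_cancel] at h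
  rw [h]
  exact ψ.norm_coe_le_norm _

theorem IsSolution.segment_initial (hx : IsSolution f t₀ ψ u ⊤ x) : segment τ x t₀ = ψ := by
  ext1 s
  rw [segment_apply (hx.continuousOn_Icc le_rfl t₀), hx.initial]

/-- A solution restarted at a later time. -/
theorem IsSolution.restart (hx : IsSolution f t₀ ψ u ⊤ x) {s : ℝ} (hs : t₀ ≤ s) :
    IsSolution f s (segment τ x s) u ⊤ x where
  lt_end := EReal.coe_lt_top _
  continuousOn := hx.continuousOn.mono fun _ ht => ⟨(by linarith [ht.1]), ht.2⟩
  initial σ := (segment_apply (hx.continuousOn_Icc (by linarith) s) σ).symm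
  absolutelyContinuous b hb _ := by
    refine (hx.absolutelyContinuous b (hs.trans hb) (EReal.coe_lt_top _)).mono ?_
    rw [uIcc_of_le hb, uIcc_of_le (hs.trans hb)]
    exact Icc_subset_Icc_left hs
  equation := hx.equation.mono fun _ h hst hT => h (hs.trans hst) hT

theorem IsSolution.norm_segment_le (hx : IsSolution f t₀ ψ u ⊤ x) {t R : ℝ} (ht : t₀ ≤ t)
    (hψ : ‖ψ‖ ≤ R) (h : ∀ s ∈ Icc t₀ t, ‖x s‖ ≤ R) : ‖segment τ x t‖ ≤ R := by
  refine RetardedSystem.norm_segment_le ((norm_nonneg _).trans hψ)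
    (hx.continuousOn_Icc (by linarith) t) fun s hs => ?_
  rcases le_total t₀ s with h0 | h0
  · exact h s ⟨h0, hs.2⟩
  · exact (hx.norm_le_of_le (by linarith [hs.1]) h0).trans hψ

/-! ### Comparison of a solution with the zero-input solution -/

/-- Grönwall estimate for the distance to the zero-input solution. -/
theorem IsSolution.norm_sub_le (hτ : 0 ≤ τ) {γ : ℝ≥0 → ℝ≥0} (hγ : IsClassK γ) (hu : IsInput u)
    (ht₀ : 0 ≤ t₀) (hx : IsSolution f t₀ ψ u ⊤ x) (hz : IsSolution f t₀ ψ (fun _ => 0) ⊤ z)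
    {t₁ R L ε C : ℝ} (hL : 0 < L) (hε : 0 ≤ ε) (hC : 0 ≤ C)
    (hxR : ∀ t ∈ Icc t₀ t₁, ‖segment τ x t‖ ≤ R) (hzR : ∀ t ∈ Icc t₀ t₁, ‖segment τ z t‖ ≤ R)
    (hfL : ∀ (t : ℝ) (ψ φ : History τ n), 0 ≤ t → ‖ψ‖ ≤ R → ‖φ‖ ≤ R →
      ‖f t ψ 0 - f t φ 0‖ ≤ L * ‖ψ - φ‖)
    (hfu : ∀ (t : ℝ) (ψ : History τ n) (μ : EuclideanSpace ℝ (Fin m)), 0 ≤ t → ‖ψ‖ ≤ R →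
      ‖f t ψ μ - f t ψ 0‖ ≤ ε + C * γ ‖μ‖₊) :
    ∀ t ∈ Icc t₀ t₁, ‖x t - z t‖ ≤
      (ε * (t₁ - t₀) + C * energyOn γ u t₀ t₁) * Real.exp (L * (t - t₀)) := by
  rcases lt_or_ge t₁ t₀ with hlt | h01
  · intro t ht
    exact absurd (ht.1.trans ht.2) (not_le.2 hlt)
  have hxz : ∀ s, t₀ - τ ≤ s → s ≤ t₀ → x s = z s := fun s h1 h2 => by
    have h := (hx.initial ⟨s - t₀, by linarith, by linarith⟩).trans
      (hz.initial ⟨s - t₀, by linarith, by linarith⟩).symm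
    simpa only [add_sub_cancel] using h
  refine le_mul_exp_of_forall_le ?_ ?_ ?_
  · have := sub_nonneg.2 h01
    positivity
  · exact ((hx.continuousOn_Icc (by linarith) t₁).sub (hz.continuousOn_Icc (by linarith) t₁)).norm
  intro t ht M hM hbd
  have hγi := hγ.intervalIntegrable hu ht₀ (ht₀.trans ht.1)
  have hei : IntervalIntegrable (fun s => L * (M * Real.exp (L * (s - t₀)))) volume t₀ t :=
    (by fun_prop : Continuous fun s => L * (M * Real.exp (L * (s - t₀)))).intervalIntegrable _ _
  have hεi : IntervalIntegrable (fun _ => ε) volume t₀ t := intervalIntegrable_const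
  have hint := (hεi.add (hγi.const_mul C)).add hei
  have key := AbsolutelyContinuousOnInterval.norm_sub_le_integral ht.1
    ((hx.absolutelyContinuous t ht.1 (EReal.coe_lt_top _)).sub
      (hz.absolutelyContinuous t ht.1 (EReal.coe_lt_top _))) hint (by
    filter_upwards [hx.equation, hz.equation] with s hxs hzs hs
    refine ⟨_, (hxs hs.1.le (EReal.coe_lt_top _)).sub (hzs hs.1.le (EReal.coe_lt_top _)), ?_⟩
    have hs' : s ∈ Icc t₀ t₁ := ⟨hs.1.le, hs.2.le.trans ht.2⟩
    have hs0 : 0 ≤ s := ht₀.trans hs.1.le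
    have h1 := hfu s _ (u s) hs0 (hxR s hs')
    have h2 := hfL s _ _ hs0 (hxR s hs') (hzR s hs')
    -- The delay is harmless: the exponential is increasing, and before `t₀` both solutions equal
    -- the initial state.
    have h3 : ‖segment τ x s - segment τ z s‖ ≤ M * Real.exp (L * (s - t₀)) := by
      refine (ContinuousMap.norm_le _ (by positivity)).2 fun σ => ?_
      have hσ1 := σ.2.1
      have hσ2 := σ.2.2
      rw [ContinuousMap.sub_apply, segment_apply (hx.continuousOn_Icc (by linarith [hs.1]) s),
        segment_apply (hz.continuousOn_Icc (by linarith [hs.1]) s)]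
      rcases le_total t₀ (s + σ) with h0 | h0
      · refine (hbd _ ⟨h0, by linarith [hs.2]⟩).trans ?_
        gcongr
        linarith
      · rw [hxz _ (by linarith [hs.1]) h0, sub_self, norm_zero]
        positivity
    calc ‖f s (segment τ x s) (u s) - f s (segment τ z s) 0‖
        = ‖(f s (segment τ x s) (u s) - f s (segment τ x s) 0)
          + (f s (segment τ x s) 0 - f s (segment τ z s) 0)‖ := by rw [sub_add_sub_cancel]
      _ ≤ (ε + C * γ ‖u s‖₊) + L * (M * Real.exp (L * (s - t₀))) :=
        (norm_add_le _ _).trans (add_le_add h1 (h2.trans (by gcongr))))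
  have hexp : ∫ s in t₀..t, L * (M * Real.exp (L * (s - t₀))) = M * (Real.exp (L * (t - t₀)) - 1) := by
    have hder : ∀ s ∈ uIcc t₀ t, HasDerivAt (fun s => M * Real.exp (L * (s - t₀)))
        (L * (M * Real.exp (L * (s - t₀)))) s := fun s _ => by
      have h := ((((hasDerivAt_id s).sub_const t₀).const_mul L).exp).const_mul M
      exact h.congr_deriv (by simp only [id]; ring)
    rw [intervalIntegral.integral_eq_sub_of_hasDerivAt hder hei]
    simp
    ring
  have hsplit : ∫ s in t₀..t, ((ε + C * (γ ‖u s‖₊ : ℝ)) + L * (M * Real.exp (L * (s - t₀))))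
      = (ε * (t - t₀) + C * energyOn γ u t₀ t) + M * (Real.exp (L * (t - t₀)) - 1) := by
    rw [intervalIntegral.integral_add (hεi.add (hγi.const_mul C)) hei,
      intervalIntegral.integral_add hεi (hγi.const_mul C), hexp,
      intervalIntegral.integral_const_mul, coe_energyOn hγ hu ht₀ ht.1]
    simp [mul_comm]
  have hE : (energyOn γ u t₀ t : ℝ) ≤ energyOn γ u t₀ t₁ :=
    NNReal.coe_le_coe.2 (energyOn_le_energyOn hγ hu ht₀ le_rfl ht.1 ht.2)
  have hstart := hxz t₀ (by linarith) le_rfl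
  rw [hsplit, Pi.sub_apply, Pi.sub_apply, hstart, sub_self, sub_zero] at key
  refine key.trans ?_
  have := ht.2
  gcongr

/-- The effect of the input on the right-hand side, on bounded sets of states. -/
theorem exists_norm_sub_zero_input_le {γ : ℝ≥0 → ℝ≥0} (hR1 : ConditionR1 f γ)
    (hR2 : ConditionR2 f) {R ε : ℝ} (hR : 0 < R) (hε : 0 < ε) :
    ∃ C : ℝ, 0 < C ∧ ∀ (t : ℝ) (ψ : History τ n) (μ : EuclideanSpace ℝ (Fin m)), 0 ≤ t →
      ‖ψ‖ ≤ R → ‖f t ψ μ - f t ψ 0‖ ≤ ε + C * γ ‖μ‖₊ := by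
  obtain ⟨hγ, N, hN0, hN, hfN⟩ := hR1
  obtain ⟨δ, hδ, hfδ⟩ := hR2 R ε hR hε
  lift R to ℝ≥0 using hR.le
  lift δ to ℝ≥0 using hδ.le
  have hγδ : 0 < γ δ := hγ.map_zero ▸ hγ.strictMono (NNReal.coe_pos.1 hδ)
  have hNR : (0 : ℝ) < N R := NNReal.coe_pos.2 (hN0 R)
  have hγδ' : (0 : ℝ) < γ δ := NNReal.coe_pos.2 hγδ
  -- For `‖μ‖ ≤ δ` the term `ε` suffices by (R2). Otherwise (R1) bounds the difference by `N R * (2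
  -- + γ ‖μ‖₊)`, and `γ δ ≤ γ ‖μ‖₊` absorbs the constant `2`.
  refine ⟨N R * (1 + 2 / γ δ), by positivity, fun t ψ μ ht hψ => ?_⟩
  rcases le_total ‖μ‖ δ with hμ | hμ
  · have := (hfδ t ψ μ ht hψ hμ).le
    have h0 : (0 : ℝ) ≤ N R * (1 + 2 / γ δ) * γ ‖μ‖₊ := by positivity
    linarith
  · have hbd : ∀ ν, ‖f t ψ ν‖ ≤ N R * (1 + γ ‖ν‖₊) := fun ν => by
      have h := (hfN t ψ ν ht).trans (mul_le_mul_left (hN (show ‖ψ‖₊ ≤ R from hψ)) _)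
      exact_mod_cast h
    have h1 := hbd μ
    have h2 := hbd 0
    have h3 : (γ δ : ℝ) ≤ γ ‖μ‖₊ := NNReal.coe_le_coe.2 (hγ.strictMono.monotone hμ)
    have h4 : 2 ≤ 2 / (γ δ : ℝ) * γ ‖μ‖₊ := by
      rw [div_mul_eq_mul_div, le_div_iff₀ hγδ']
      linarith
    simp only [nnnorm_zero, hγ.map_zero, NNReal.coe_zero, add_zero, mul_one] at h2
    calc ‖f t ψ μ - f t ψ 0‖ ≤ N R * (1 + γ ‖μ‖₊) + N R := (norm_sub_le _ _).trans (add_le_add h1 h2)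
      _ = N R * (2 + γ ‖μ‖₊) := by ring
      _ ≤ N R * (2 / (γ δ : ℝ) * γ ‖μ‖₊ + γ ‖μ‖₊) := by gcongr
      _ = N R * (1 + 2 / γ δ) * γ ‖μ‖₊ := by ring
      _ ≤ ε + N R * (1 + 2 / γ δ) * γ ‖μ‖₊ := le_add_of_nonneg_left hε.le

end Solutions

/-! ### Tracking, smallness, attraction and the iISS estimate. -/

section Tracking

variable {n m : ℕ} {τ : ℝ}
  {f : ℝ → History τ n → EuclideanSpace ℝ (Fin m) → EuclideanSpace ℝ (Fin n)}
  {γ κ : ℝ≥0 → ℝ≥0} {β : ℝ≥0 → ℝ≥0 → ℝ≥0}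

theorem IsClassKInf.max {α γ : ℝ≥0 → ℝ≥0} (hα : IsClassKInf α) (hγ : IsClassKInf γ) :
    IsClassKInf fun r => max (α r) (γ r) where
  continuous := hα.continuous.max hγ.continuous
  strictMono := fun _ _ h => max_lt_max (hα.strictMono h) (hγ.strictMono h)
  map_zero := by simp [hα.map_zero, hγ.map_zero]
  unbounded := by
    rintro ⟨M, hM⟩
    refine hα.unbounded ⟨M, ?_⟩
    rintro _ ⟨r, rfl⟩
    exact (le_max_left _ _).trans (hM ⟨r, rfl⟩)

/-- The bound of the zero-input solutions by `β`, in the form of an existence statement. -/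
def HasZeroInputBound
    (f : ℝ → History τ n → EuclideanSpace ℝ (Fin m) → EuclideanSpace ℝ (Fin n))
    (β : ℝ≥0 → ℝ≥0 → ℝ≥0) : Prop :=
  ∀ (t₀ : ℝ) (ψ : History τ n), 0 ≤ t₀ → ∃ z, IsSolution f t₀ ψ (fun _ => 0) ⊤ z ∧
    ∀ t, t₀ ≤ t → ‖z t‖₊ ≤ β ‖ψ‖₊ (t - t₀).toNNReal

/-- If the zero-input solutions are bounded by `β`, then solutions in a given ball are bounded
by `β` up to a small error on intervals of bounded length on which the input has small energy. -/
theorem exists_norm_le_add_of_energyOn_le (hτ : 0 ≤ τ) (hR1 : ConditionR1 f γ)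
    (hR2 : ConditionR2 f) (hR3 : ConditionR3 f) (hβ : IsClassKL β) (hz : HasZeroInputBound f β)
    {R p η : ℝ} (hR : 0 < R) (hp : 0 ≤ p) (hη : 0 < η) :
    ∃ δ : ℝ≥0, 0 < δ ∧ ∀ (t₀ t₁ : ℝ) (ψ : History τ n) (u : ℝ → EuclideanSpace ℝ (Fin m))
      (x : ℝ → EuclideanSpace ℝ (Fin n)), 0 ≤ t₀ → t₁ ≤ t₀ + p → IsInput u →
      IsSolution f t₀ ψ u ⊤ x → (∀ t ∈ Icc t₀ t₁, ‖segment τ x t‖ ≤ R) →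
      energyOn γ u t₀ t₁ ≤ δ →
      ∀ t ∈ Icc t₀ t₁, ‖x t‖ ≤ β ‖ψ‖₊ (t - t₀).toNNReal + η := by
  have hγ := hR1.1.toIsClassK
  -- A radius for both solutions: the zero-input solution may leave the ball of radius `R`.
  set R' : ℝ := max R (β R.toNNReal 0)
  have hRR' : R ≤ R' := le_max_left _ _
  have hR' : 0 < R' := hR.trans_le hRR'
  obtain ⟨L₀, hL₀⟩ := hR3 R' hR'
  set L : ℝ := max L₀ 1
  have hL : 0 < L := one_pos.trans_le (le_max_right _ _)
  have hfL : ∀ (t : ℝ) (ψ φ : History τ n), 0 ≤ t → ‖ψ‖ ≤ R' → ‖φ‖ ≤ R' →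
      ‖f t ψ 0 - f t φ 0‖ ≤ L * ‖ψ - φ‖ := fun t ψ φ ht hψ hφ =>
    (hL₀ t ψ φ ht hψ hφ).trans (by gcongr; exact le_max_left _ _)
  set K : ℝ := Real.exp (L * p)
  have hK : 0 < K := Real.exp_pos _
  -- Half of `η` is for `ε * (t₁ - t₀)`, half for the energy term; `K` offsets the Grönwall factor,
  -- and `p + 1` is nonzero even for `p = 0`.
  set ε : ℝ := η / 2 / K / (p + 1)
  have hε : 0 < ε := by positivity
  obtain ⟨C, hC, hfu⟩ := exists_norm_sub_zero_input_le hR1 hR2 hR' hε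
  refine ⟨(η / 2 / K / C).toNNReal, Real.toNNReal_pos.2 (by positivity), ?_⟩
  intro t₀ t₁ ψ u x ht₀ ht₁ hu hx hxR hE t ht
  obtain ⟨z, hzs, hzβ⟩ := hz t₀ ψ ht₀
  have hψ : ‖ψ‖ ≤ R := hx.segment_initial ▸ hxR t₀ ⟨le_rfl, ht.1.trans ht.2⟩
  have hψ' : ‖ψ‖₊ ≤ R.toNNReal := NNReal.le_toNNReal_of_coe_le hψ
  have hzR : ∀ s ∈ Icc t₀ t₁, ‖segment τ z s‖ ≤ R' := fun s hs =>
    hzs.norm_segment_le hs.1 (hψ.trans hRR') fun σ hσ => by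
      refine le_trans ?_ (le_max_right _ _)
      refine NNReal.coe_le_coe.2 ((hzβ σ hσ.1).trans ?_)
      exact ((hβ.antitone _ zero_le).trans ((hβ.classK 0).strictMono.monotone hψ'))
  have hE' : (energyOn γ u t₀ t₁ : ℝ) ≤ η / 2 / K / C := by
    rw [← Real.coe_toNNReal (η / 2 / K / C) (by positivity)]
    exact NNReal.coe_le_coe.2 hE
  have h := hx.norm_sub_le hτ hγ hu ht₀ hzs hL hε.le hC.le (fun s hs => (hxR s hs).trans hRR')
    hzR hfL hfu t ht
  have hbound : (ε * (t₁ - t₀) + C * energyOn γ u t₀ t₁) * Real.exp (L * (t - t₀)) ≤ η := by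
    have h1 : ε * (t₁ - t₀) ≤ η / 2 / K := by
      calc ε * (t₁ - t₀) ≤ ε * (p + 1) := by gcongr; linarith
        _ = η / 2 / K := div_mul_cancel₀ _ (by positivity)
    have h2 : C * energyOn γ u t₀ t₁ ≤ η / 2 / K := by
      calc C * (energyOn γ u t₀ t₁ : ℝ) ≤ C * (η / 2 / K / C) := by gcongr
        _ = η / 2 / K := mul_div_cancel₀ _ hC.ne'
    have h3 : Real.exp (L * (t - t₀)) ≤ K := by
      refine Real.exp_le_exp.2 (mul_le_mul_of_nonneg_left ?_ hL.le)
      linarith [ht.2]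
    calc (ε * (t₁ - t₀) + C * energyOn γ u t₀ t₁) * Real.exp (L * (t - t₀))
        ≤ (η / 2 / K + η / 2 / K) * K := by gcongr
      _ = η := by field_simp; ring
  have hzt : ‖z t‖ ≤ β ‖ψ‖₊ (t - t₀).toNNReal := NNReal.coe_le_coe.2 (hzβ t ht.1)
  calc ‖x t‖ = ‖z t + (x t - z t)‖ := by rw [add_sub_cancel]
    _ ≤ ‖z t‖ + ‖x t - z t‖ := norm_add_le _ _
    _ ≤ β ‖ψ‖₊ (t - t₀).toNNReal + η := add_le_add hzt (h.trans hbound)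

/-- Solutions are bounded, uniformly over bounded initial states and bounded energies. -/
def IsUniformlyBounded
    (f : ℝ → History τ n → EuclideanSpace ℝ (Fin m) → EuclideanSpace ℝ (Fin n))
    (κ : ℝ≥0 → ℝ≥0) : Prop :=
  ∀ r : ℝ≥0, ∃ R : ℝ≥0, 0 < R ∧ ∀ (t₀ t : ℝ) (ψ : History τ n) (u : ℝ → EuclideanSpace ℝ (Fin m))
    (x : ℝ → EuclideanSpace ℝ (Fin n)), 0 ≤ t₀ → t₀ ≤ t → IsInput u → IsSolution f t₀ ψ u ⊤ x →
    ‖ψ‖₊ ≤ r → energyOn κ u t₀ t ≤ r → ∀ s ∈ Icc t₀ t, ‖segment τ x s‖ ≤ R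

/-- A bound on the `κ`-energy bounds the `α`-energy. This is why the final gain must dominate `α`;
it must dominate `γ` for tracking. -/
theorem UBEBSWithGain.isUniformlyBounded {α : ℝ≥0 → ℝ≥0} (h : UBEBSWithGain f α)
    (hκ : IsClassK κ) (hακ : ∀ r, α r ≤ κ r) : IsUniformlyBounded f κ := by
  obtain ⟨-, a, ρ, c, ha, hρ, H⟩ := h
  intro r
  refine ⟨max r (a r + ρ r + c) + 1, by positivity, ?_⟩
  intro t₀ t ψ u x ht₀ ht hu hx hψ hE s hs
  refine hx.norm_segment_le hs.1 (NNReal.coe_le_coe.2 (hψ.trans ?_)) fun σ hσ => ?_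
  · exact (le_max_left _ _).trans le_self_add
  · have h1 := (H t₀ ψ u ⊤ x ht₀ hu hx.isMaximalSolution).2 σ hσ.1
    have h2 : energyOn α u t₀ σ ≤ r := (energyOn_mono_left hκ hu hακ t₀ σ).trans
      ((energyOn_le_energyOn hκ hu ht₀ le_rfl hσ.1 (hσ.2.trans hs.2)).trans hE)
    refine NNReal.coe_le_coe.2 (h1.trans ?_)
    calc a ‖ψ‖₊ + ρ (energyOn α u t₀ σ) + c ≤ a r + ρ r + c :=
          add_le_add_left (add_le_add (ha.strictMono.monotone hψ) (hρ.strictMono.monotone h2)) c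
      _ ≤ _ := (le_max_right _ _).trans le_self_add

theorem IsClassKL.exists_le_zero_time (hβ : IsClassKL β) {ε : ℝ≥0} (hε : 0 < ε) :
    ∃ δ, 0 < δ ∧ β δ 0 ≤ ε := by
  have h : Tendsto (fun r => β r 0) (𝓝 0) (𝓝 0) := by
    have := (hβ.classK 0).continuous.tendsto 0
    rwa [(hβ.classK 0).map_zero] at this
  have hev : ∀ᶠ r in 𝓝[>] (0 : ℝ≥0), β r 0 < ε ∧ 0 < r :=
    ((h.eventually (gt_mem_nhds hε)).filter_mono nhdsWithin_le_nhds).and self_mem_nhdsWithin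
  obtain ⟨δ, h1, h2⟩ := hev.exists
  exact ⟨δ, h2, h1.le⟩

theorem IsClassKL.exists_forall_ge_le (hβ : IsClassKL β) (r : ℝ≥0) {ε : ℝ≥0} (hε : 0 < ε) :
    ∃ T, ∀ t, T ≤ t → β r t ≤ ε := by
  obtain ⟨T, hT⟩ := ((hβ.tendsto_zero r).eventually (gt_mem_nhds hε)).exists
  exact ⟨T, fun t ht => (hβ.antitone r ht).trans hT.le⟩

/-- Over one period, a low-energy input drives states of norm at most `r` into a small ball. -/
theorem exists_period_norm_segment_le (hτ : 0 ≤ τ) (hR1 : ConditionR1 f γ)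
    (hR2 : ConditionR2 f) (hR3 : ConditionR3 f) (hβ : IsClassKL β) (hz : HasZeroInputBound f β)
    {R : ℝ} (hR : 0 < R) {r η : ℝ≥0} (hη : 0 < η) :
    ∃ (p : ℝ) (δ : ℝ≥0), 0 < p ∧ 0 < δ ∧
      ∀ (t₀ t₁ : ℝ) (ψ : History τ n) (u : ℝ → EuclideanSpace ℝ (Fin m))
        (x : ℝ → EuclideanSpace ℝ (Fin n)), 0 ≤ t₀ → t₁ ≤ t₀ + p → IsInput u →
        IsSolution f t₀ ψ u ⊤ x → (∀ t ∈ Icc t₀ t₁, ‖segment τ x t‖ ≤ R) → ‖ψ‖₊ ≤ r →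
        energyOn γ u t₀ t₁ ≤ δ →
        (∀ t ∈ Icc t₀ t₁, ‖x t‖ ≤ β r 0 + η) ∧ (t₁ = t₀ + p → ‖segment τ x t₁‖ ≤ η + η) := by
  obtain ⟨T, hT⟩ := hβ.exists_forall_ge_le r hη
  have hp : 0 < τ + T + 1 := by positivity
  obtain ⟨δ, hδ, H⟩ := exists_norm_le_add_of_energyOn_le hτ hR1 hR2 hR3 hβ hz hR hp.le
    (NNReal.coe_pos.2 hη)
  -- `T` is the decay time; the extra `τ` places the whole final segment after it, and `1` makes the
  -- period positive.
  refine ⟨τ + T + 1, δ, hp, hδ, ?_⟩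
  intro t₀ t₁ ψ u x ht₀ ht₁ hu hx hxR hψ hE
  have h := H t₀ t₁ ψ u x ht₀ ht₁ hu hx hxR hE
  have hmono : ∀ s, β ‖ψ‖₊ s ≤ β r s := fun s => (hβ.classK s).strictMono.monotone hψ
  refine ⟨fun t ht => (h t ht).trans ?_, ?_⟩
  · gcongr
    exact (hmono _).trans (hβ.antitone r zero_le)
  · rintro rfl
    have hT0 : (0 : ℝ) ≤ T := T.coe_nonneg
    refine norm_segment_le (by positivity) (hx.continuousOn_Icc (by linarith) _) fun s hs => ?_
    refine (h s ⟨by linarith [hs.1], hs.2⟩).trans ?_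
    gcongr
    refine (hmono _).trans (hT _ (NNReal.le_toNNReal_of_coe_le ?_))
    linarith [hs.1]

/-- Small initial states and small energies yield small solutions. -/
theorem exists_norm_le_of_small (hτ : 0 ≤ τ) (hR1 : ConditionR1 f γ) (hR2 : ConditionR2 f)
    (hR3 : ConditionR3 f) (hβ : IsClassKL β) (hz : HasZeroInputBound f β) (hκ : IsClassK κ)
    (hγκ : ∀ r, γ r ≤ κ r) (hbdd : IsUniformlyBounded f κ) {ε : ℝ≥0} (hε : 0 < ε) :
    ∃ δ : ℝ≥0, 0 < δ ∧ ∀ (t₀ t : ℝ) (ψ : History τ n) (u : ℝ → EuclideanSpace ℝ (Fin m))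
      (x : ℝ → EuclideanSpace ℝ (Fin n)), 0 ≤ t₀ → t₀ ≤ t → IsInput u →
      IsSolution f t₀ ψ u ⊤ x → ‖ψ‖₊ ≤ δ → energyOn κ u t₀ t ≤ δ → ‖x t‖₊ ≤ ε := by
  obtain ⟨R, hR, hbd⟩ := hbdd 1
  obtain ⟨δ₀, hδ₀, hβδ₀⟩ := hβ.exists_le_zero_time (half_pos hε)
  -- The invariant radius: a period started in this ball ends in it, with error `r / 2 + r / 2`, and
  -- in between the norm is at most `β r 0 + r / 2 ≤ ε`.
  set r : ℝ≥0 := min δ₀ ε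
  have hr0 : 0 < r := lt_min hδ₀ hε
  have hβr : β r 0 ≤ ε / 2 := ((hβ.classK 0).strictMono.monotone (min_le_left _ _)).trans hβδ₀
  obtain ⟨p, δ₁, hp, hδ₁, H⟩ := exists_period_norm_segment_le hτ hR1 hR2 hR3 hβ hz
    (NNReal.coe_pos.2 hR) (r := r) (half_pos hr0)
  refine ⟨min (min r δ₁) 1, lt_min (lt_min hr0 hδ₁) one_pos, ?_⟩
  intro t₀ t ψ u x ht₀ ht hu hx hψ hE
  have hxR := hbd t₀ t ψ u x ht₀ ht hu hx (hψ.trans (min_le_right _ _))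
    (hE.trans (min_le_right _ _))
  have hEδ : ∀ a b, t₀ ≤ a → a ≤ b → b ≤ t → energyOn γ u a b ≤ δ₁ := fun a b ha hab hb =>
    (energyOn_mono_left hκ hu hγκ a b).trans ((energyOn_le_energyOn hκ hu ht₀ ha hab hb).trans
      (hE.trans ((min_le_left _ _).trans (min_le_right _ _))))
  have hstep : ∀ k : ℕ, t₀ + k * p ≤ t → ‖segment τ x (t₀ + k * p)‖₊ ≤ r := by
    intro k
    induction k with
    | zero =>
      intro _
      simpa [hx.segment_initial] using hψ.trans ((min_le_left _ _).trans (min_le_left _ _))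
    | succ k ih =>
      intro hk
      push_cast at hk ⊢
      have hs : t₀ ≤ t₀ + k * p := le_add_of_nonneg_right (by positivity)
      have hs' : t₀ + k * p ≤ t₀ + (k + 1) * p := by nlinarith
      have h := (H (t₀ + k * p) (t₀ + (k + 1) * p) _ u x (ht₀.trans hs) (by linarith) hu
        (hx.restart hs) (fun σ hσ => hxR σ ⟨hs.trans hσ.1, hσ.2.trans hk⟩) (ih (hs'.trans hk))
        (hEδ _ _ hs hs' hk)).2 (by ring)
      rw [← NNReal.coe_add, add_halves] at h
      exact NNReal.coe_le_coe.1 h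
  set k : ℕ := ⌊(t - t₀) / p⌋₊
  have hk1 : k * p ≤ t - t₀ := by
    rw [← le_div_iff₀ hp]
    exact Nat.floor_le (div_nonneg (sub_nonneg.2 ht) hp.le)
  have hk2 : t - t₀ ≤ (k + 1) * p := by
    rw [← div_le_iff₀ hp]
    exact (Nat.lt_floor_add_one _).le
  have hs : t₀ ≤ t₀ + k * p := le_add_of_nonneg_right (by positivity)
  have hst : t₀ + k * p ≤ t := by linarith
  have h := (H (t₀ + k * p) t _ u x (ht₀.trans hs) (by linarith) hu (hx.restart hs)
    (fun σ hσ => hxR σ ⟨hs.trans hσ.1, hσ.2⟩) (hstep k hst) (hEδ _ _ hs hst le_rfl)).1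
    t ⟨hst, le_rfl⟩
  rw [← NNReal.coe_add] at h
  refine (show ‖x t‖₊ ≤ β r 0 + r / 2 from h).trans ?_
  have hrε : r / 2 ≤ ε / 2 := by
    gcongr
    exact min_le_right _ _
  exact (add_le_add hβr hrε).trans (add_halves ε).le

/-- Solutions reach every ball within a time that depends only on bounds for the initial state
and the energy. -/
theorem exists_time_norm_segment_le (hτ : 0 ≤ τ) (hR1 : ConditionR1 f γ) (hR2 : ConditionR2 f)
    (hR3 : ConditionR3 f) (hβ : IsClassKL β) (hz : HasZeroInputBound f β) (hκ : IsClassK κ)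
    (hγκ : ∀ r, γ r ≤ κ r) (hbdd : IsUniformlyBounded f κ) (r : ℝ≥0) {ε : ℝ≥0} (hε : 0 < ε) :
    ∃ T : ℝ≥0, ∀ (t₀ t : ℝ) (ψ : History τ n) (u : ℝ → EuclideanSpace ℝ (Fin m))
      (x : ℝ → EuclideanSpace ℝ (Fin n)), 0 ≤ t₀ → t₀ + T ≤ t → IsInput u →
      IsSolution f t₀ ψ u ⊤ x → ‖ψ‖₊ ≤ r → energyOn κ u t₀ t ≤ r →
      ∃ s ∈ Icc t₀ t, ‖segment τ x s‖₊ ≤ ε := by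
  obtain ⟨R, hR, hbd⟩ := hbdd r
  -- The initial radius is `R`, not `r`: the low-energy period may come late, when only the uniform
  -- bound is known.
  obtain ⟨p, δ, hp, hδ, H⟩ := exists_period_norm_segment_le hτ hR1 hR2 hR3 hβ hz
    (NNReal.coe_pos.2 hR) (r := R) (half_pos hε)
  obtain ⟨K, hK⟩ := exists_lt_nsmul hδ r
  refine ⟨(K * p).toNNReal, ?_⟩
  intro t₀ t ψ u x ht₀ ht hu hx hψ hE
  rw [Real.coe_toNNReal _ (by positivity)] at ht
  have hKt : t₀ ≤ t₀ + K * p := le_add_of_nonneg_right (by positivity)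
  have hxR := hbd t₀ t ψ u x ht₀ (hKt.trans ht) hu hx hψ hE
  obtain ⟨j, hj, hjδ⟩ : ∃ j < K, energyOn κ u (t₀ + j * p) (t₀ + (j + 1) * p) < δ := by
    by_contra! hcon
    have h := nsmul_le_energyOn hκ hu ht₀ hp.le K hcon
    exact absurd (h.trans ((energyOn_le_energyOn hκ hu ht₀ le_rfl hKt ht).trans hE)) (not_le.2 hK)
  have hs : t₀ ≤ t₀ + j * p := le_add_of_nonneg_right (by positivity)
  have hs' : t₀ + j * p ≤ t₀ + (j + 1) * p := by nlinarith
  have hst : t₀ + (j + 1) * p ≤ t := by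
    have : ((j : ℝ) + 1) ≤ K := by exact_mod_cast hj
    nlinarith
  refine ⟨t₀ + (j + 1) * p, ⟨hs.trans hs', hst⟩, ?_⟩
  have h := (H (t₀ + j * p) (t₀ + (j + 1) * p) _ u x (ht₀.trans hs) (by linarith) hu
    (hx.restart hs) (fun σ hσ => hxR σ ⟨hs.trans hσ.1, hσ.2.trans hst⟩)
    (NNReal.coe_le_coe.1 (hxR _ ⟨hs, hs'.trans hst⟩))
    ((energyOn_mono_left hκ hu hγκ _ _).trans hjδ.le)).2 (by ring)
  rw [← NNReal.coe_add, add_halves] at h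
  exact NNReal.coe_le_coe.1 h

/-- The solutions satisfy an iISS estimate. -/
theorem exists_iISS_estimate (hτ : 0 ≤ τ) (hR1 : ConditionR1 f γ) (hR2 : ConditionR2 f)
    (hR3 : ConditionR3 f) (hβ : IsClassKL β) (hz : HasZeroInputBound f β) (hκ : IsClassK κ)
    (hγκ : ∀ r, γ r ≤ κ r) (hbdd : IsUniformlyBounded f κ) :
    ∃ (β' : ℝ≥0 → ℝ≥0 → ℝ≥0) (ρ : ℝ≥0 → ℝ≥0), IsClassKL β' ∧ IsClassKInf ρ ∧
      ∀ (t₀ t : ℝ) (ψ : History τ n) (u : ℝ → EuclideanSpace ℝ (Fin m))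
        (x : ℝ → EuclideanSpace ℝ (Fin n)), 0 ≤ t₀ → t₀ ≤ t → IsInput u →
        IsSolution f t₀ ψ u ⊤ x →
        ‖x t‖₊ ≤ β' ‖ψ‖₊ (t - t₀).toNNReal + ρ (energyOn κ u t₀ t) := by
  have key := exists_isClassKL_add_isClassKInf_ge
    (Q := fun r e d v => ∃ (t₀ t : ℝ) (ψ : History τ n) (u : ℝ → EuclideanSpace ℝ (Fin m))
      (x : ℝ → EuclideanSpace ℝ (Fin n)), 0 ≤ t₀ ∧ t₀ ≤ t ∧ IsInput u ∧
      IsSolution f t₀ ψ u ⊤ x ∧ r = ‖ψ‖₊ ∧ e = energyOn κ u t₀ t ∧ d = (t - t₀).toNNReal ∧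
      v = ‖x t‖₊)
  refine (key ?_ ?_ ?_).imp fun β' ⟨ρ, hβ', hρ, H⟩ =>
    ⟨ρ, hβ', hρ, fun t₀ t ψ u x ht₀ ht hu hx =>
      H _ _ _ _ ⟨t₀, t, ψ, u, x, ht₀, ht, hu, hx, rfl, rfl, rfl, rfl⟩⟩
  · intro r
    obtain ⟨R, -, hbd⟩ := hbdd r
    refine ⟨R, ?_⟩
    rintro _ _ _ _ hψ hE ⟨t₀, t, ψ, u, x, ht₀, ht, hu, hx, rfl, rfl, rfl, rfl⟩
    have h := hbd t₀ t ψ u x ht₀ ht hu hx hψ hE t ⟨ht, le_rfl⟩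
    have h0 := (segment τ x t).norm_coe_le_norm ⟨0, by linarith, le_rfl⟩
    rw [segment_apply (hx.continuousOn_Icc (by linarith) t), add_zero] at h0
    exact NNReal.coe_le_coe.1 (h0.trans h)
  · intro ε hε
    obtain ⟨δ, hδ, h⟩ := exists_norm_le_of_small hτ hR1 hR2 hR3 hβ hz hκ hγκ hbdd hε
    refine ⟨δ, hδ, ?_⟩
    rintro _ _ _ _ hψ hE ⟨t₀, t, ψ, u, x, ht₀, ht, hu, hx, rfl, rfl, rfl, rfl⟩
    exact h t₀ t ψ u x ht₀ ht hu hx hψ hE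
  · intro r ε hε
    obtain ⟨T, h⟩ := exists_time_norm_segment_le hτ hR1 hR2 hR3 hβ hz hκ hγκ hbdd r hε
    refine ⟨T, ?_⟩
    rintro _ _ _ _ hψ hE hT ⟨t₀, t, ψ, u, x, ht₀, ht, hu, hx, rfl, rfl, rfl, rfl⟩
    have hT' : (T : ℝ) ≤ t - t₀ := by
      rw [← Real.coe_toNNReal (t - t₀) (sub_nonneg.2 ht)]
      exact NNReal.coe_le_coe.2 hT
    obtain ⟨s, hs, hsε⟩ := h t₀ t ψ u x ht₀ (by linarith) hu hx hψ hE
    -- Restarting at `s` represents the same value `x t` with a small initial state and no more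
    -- energy.
    exact ⟨_, energyOn κ u s t, _, hsε, energyOn_le_energyOn hκ hu ht₀ hs.1 hs.2 le_rfl, s, t, _, u,
      x, ht₀.trans hs.1, hs.2, hu, hx.restart hs.1, rfl, rfl, rfl, rfl⟩

/-! ### The implications between the stability notions. -/

theorem IISSWithGain.zeroGUAS (h : IISSWithGain f κ) : ZeroGUAS f := by
  obtain ⟨hκ, β, ρ, hβ, hρ, H⟩ := h
  refine ⟨β, hβ, fun t₀ ψ T x ht₀ hx => ?_⟩
  obtain ⟨hT, h⟩ := H t₀ ψ _ T x ht₀ isInput_zero hx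
  refine ⟨hT, fun t ht => ?_⟩
  simpa [energyOn_zero hκ.toIsClassK, hρ.map_zero] using h t ht

theorem IISSWithGain.ubebsWithGain (h : IISSWithGain f κ) : UBEBSWithGain f κ := by
  obtain ⟨hκ, β, ρ, hβ, hρ, H⟩ := h
  -- The summand `r` makes `β r 0` unbounded, as class `K∞` demands.
  refine ⟨hκ, fun r => β r 0 + r, ρ, 0, .of_le ⟨?_, ?_, ?_⟩ fun r => le_add_self, hρ,
    fun t₀ ψ u T x ht₀ hu hx => ?_⟩
  · exact (hβ.classK 0).continuous.add continuous_id
  · exact (hβ.classK 0).strictMono.add strictMono_id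
  · simp [(hβ.classK 0).map_zero]
  · obtain ⟨hT, h⟩ := H t₀ ψ u T x ht₀ hu hx
    refine ⟨hT, fun t ht => (h t ht).trans ?_⟩
    rw [add_zero]
    gcongr
    exact (hβ.antitone _ zero_le).trans le_self_add

theorem ZeroGUAS.iISSWithGain_max {α : ℝ≥0 → ℝ≥0} (h : ZeroGUAS f) (hα : UBEBSWithGain f α)
    (hτ : 0 ≤ τ) (hf : StandingAssumptions f) (hR1 : ConditionR1 f γ) (hR2 : ConditionR2 f)
    (hR3 : ConditionR3 f) : IISSWithGain f fun r => max (α r) (γ r) := by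
  have hκ := hα.1.max hR1.1
  obtain ⟨β, hβ, hβf⟩ := h
  have hz : HasZeroInputBound f β := fun t₀ ψ ht₀ => by
    obtain ⟨T, z, hz, -⟩ := hf.existsUnique t₀ ψ _ ht₀ isInput_zero
    obtain ⟨rfl, hzβ⟩ := hβf t₀ ψ T z ht₀ hz
    exact ⟨z, hz.isSolution, hzβ⟩
  obtain ⟨β', ρ, hβ', hρ, H⟩ := exists_iISS_estimate hτ hR1 hR2 hR3 hβ hz hκ.toIsClassK
    (fun r => le_max_right _ _)
    (hα.isUniformlyBounded hκ.toIsClassK fun r => le_max_left _ _)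
  refine ⟨hκ, β', ρ, hβ', hρ, fun t₀ ψ u T x ht₀ hu hx => ?_⟩
  obtain ⟨-, a, σ, c, -, -, hU⟩ := hα
  -- UBEBS supplies global existence, so the estimate for solutions on `[t₀ - τ, ∞)` applies.
  obtain ⟨rfl, -⟩ := hU t₀ ψ u T x ht₀ hu hx
  exact ⟨rfl, fun t ht => H t₀ t ψ u x ht₀ ht hu hx.isSolution⟩

end Tracking

end RetardedSystem

end

theorem mainTheorem5 (n m : ℕ) (τ : ℝ) (hτ : 0 ≤ τ)
    (f : ℝ → RetardedSystem.History τ n → EuclideanSpace ℝ (Fin m) → EuclideanSpace ℝ (Fin n))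
    (hf : RetardedSystem.StandingAssumptions f)
    (γ : ℝ≥0 → ℝ≥0)
    (hR1 : RetardedSystem.ConditionR1 f γ)
    (hR2 : RetardedSystem.ConditionR2 f)
    (hR3 : RetardedSystem.ConditionR3 f) :
    (∀ κ : ℝ≥0 → ℝ≥0, RetardedSystem.IISSWithGain f κ →
      RetardedSystem.ZeroGUAS f ∧ RetardedSystem.UBEBSWithGain f κ) ∧
    (∀ α : ℝ≥0 → ℝ≥0, RetardedSystem.ZeroGUAS f → RetardedSystem.UBEBSWithGain f α →
      RetardedSystem.IISSWithGain f (fun r => max (α r) (γ r))) := by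
  exact ⟨fun κ h => ⟨h.zeroGUAS, h.ubebsWithGain⟩,
    fun α h hα => h.iISSWithGain_max hα hτ hf hR1 hR2 hR3⟩
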